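/- An \emph{effect algebra} is a partial algebra $(E;\oplus,0,1)$ with a partial binary operation $\oplus$ such that: (E1) if $a\oplus b$ is defined, then $b\oplus a$ is defined and $a\oplus b=b\oplus a$; (E2) if $a\oplus b$ and $(a\oplus b)\oplus c$ are defined, then $b\oplus c$ and $a\oplus(b\oplus c)$ are defined and $(a\oplus b)\oplus c=a\oplus(b\oplus c)$; (E3) for every $a\in E$ there is a unique $a'\in E$ with $a\oplus a'=1$; (E4) if $a\oplus 1$ is defined, then $a=0$. Write $a\le b$ if $a\oplus c=b$ for some $c\in E$; this $c$ is then unique and is denoted $b\ominus a$. A finite family $(c_1,\dots,c_n)$ of (not necessarily distinct) elements of $E$ is \emph{orthogonal} if $c_1\oplus\dots\oplus c_n$ exists (the empty sum being $0$); its \emph{range} is $\{c_1,\dots,c_n\}$. A finite subset $M\subseteq E$ is \emph{compatible} if there is a finite orthogonal family $(c_1,\dots,c_n)$ in $E$ such that every $a\in M$ equals $\bigoplus_{i\in A}c_i$ for some $A\subseteq\{1,\dots,n\}$. An effect algebra $E$ is \emph{homogeneous} if for all $u,v_1,v_2\in E$ such that $v_1\oplus v_2$ is defined, $u\le v_1\oplus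 v_2$ and $u\le(v_1\oplus v_2)'$, there are $u_1\le v_1$ and $u_2\le v_2$ with $u=u_1\oplus u_2$. It satisfies the \emph{Riesz decomposition property} if for all $u,v_1,\dots,v_n\in E$ such that $v_1\oplus\dots\oplus v_n$ exists and $u\le v_1\oplus\dots\oplus v_n$, there are $u_1,\dots,u_n\in E$ with $u_i\le v_i$ for all $i$ and $u=u_1\oplus\dots\oplus u_n$. A \emph{sub-effect algebra} of $E$ is a subset $F\subseteq E$ with $1\in F$ such that $a\ominus b\in F$ whenever $a,b\in F$ and $b\le a$; it is an effect algebra under the restriction of $\oplus$, with the same $0$ and $1$. A \emph{block} of $E$ is a maximal (with respect to inclusion) element of the set of sub-effect algebras of $E$ that satisfy the Riesz decomposition property. \textbf{Corollary.} For an effect algebra $E$, the following are equivalent. (a) $E$ is homogeneous. (b) Every finite compatible subset of $E$ is contained in a block of $E$. (c) Every finite compatible subset of $E$ is contained in a sub-effect algebra of $E$ satisfying the Riesz decomposition property. (d) The range of every finite orthogonal family in $E$ is contained in a block of $E$. (e) The range of every finite orthogonal family in $E$ is contained in a sub-effect algebra of $E$ satisfying the Riesz decomposition property. (f) The range of every orthogonal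 family $(c_1,c_2,c_3)$ of length three in $E$ is contained in a block of $E$. (g) The range of every orthogonal family $(c_1,c_2,c_3)$ of length three in $E$ is contained in a sub-effect algebra of $E$ satisfying the Riesz decomposition property. -/

import Mathlib

universe u

/-- An effect algebra `(E; ⊕, 0, 1)`. The partial operation is modelled by an `Option`-valued
function: `oplus a b = some c` says that `a ⊕ b` is defined and equal to `c`. -/
class EffectAlgebra (E : Type u) extends Zero E, One E where
  oplus : E → E → Option E
  oplus_comm : ∀ a b c : E, oplus a b = some c → oplus b a = some c
  oplus_assoc : ∀ a b c d e : E, oplus a b = some d → oplus d c = some e →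
    ∃ f, oplus b c = some f ∧ oplus a f = some e
  exists_unique_compl : ∀ a : E, ∃! a' : E, oplus a a' = some 1
  eq_zero_of_oplus_one : ∀ a b : E, oplus a 1 = some b → a = 0

namespace EffectAlgebra

section Basic

variable {E : Type u} [EffectAlgebra E]

/-- The orthosupplement `a'`: the unique element with `a ⊕ a' = 1`. -/
noncomputable def compl (a : E) : E := (exists_unique_compl a).choose

theorem oplus_compl (a : E) : oplus a (compl a) = some 1 :=
  (exists_unique_compl a).choose_spec.1

theorem compl_unique {a b c : E} (hb : oplus a b = some 1) (hc : oplus a c = some 1) : b = c :=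
  (exists_unique_compl a).unique hb hc

/-- `a ≤ b` iff `a ⊕ c = b` for some `c`. -/
def Le (a b : E) : Prop := ∃ c : E, oplus a c = some b

theorem compl_one : compl (1 : E) = 0 :=
  eq_zero_of_oplus_one _ 1 (oplus_comm _ _ _ (oplus_compl 1))

theorem oplus_zero (a : E) : oplus a 0 = some a := by
  have h1 : oplus (1 : E) 0 = some 1 := by
    have h := oplus_compl (1 : E)
    rwa [compl_one] at h
  have h2 : oplus (compl a) a = some 1 := oplus_comm _ _ _ (oplus_compl a)
  obtain ⟨f, hf, hf'⟩ := oplus_assoc _ _ _ _ _ h2 h1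
  rw [hf, compl_unique hf' h2]

end Basic

/-- The values of sums that need not exist: `none` stands for an undefined sum. -/
def PartialValue (E : Type u) : Type u := Option E

section Sums

variable {E : Type u} [EffectAlgebra E]

/-- The extension of `⊕` to possibly undefined arguments: the sum is defined iff both
arguments are defined and their sum exists. -/
def PartialValue.add (x y : PartialValue E) : PartialValue E :=
  Option.bind x fun a => Option.bind y fun b => oplus a b

theorem PartialValue.add_eq_some {x y : PartialValue E} {c : E} :
    PartialValue.add x y = some c ↔ ∃ a b : E, x = some a ∧ y = some b ∧ oplus a b = some c := by
  unfold PartialValue.add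
  constructor
  · intro h
    obtain ⟨a, hx, h⟩ := Option.bind_eq_some_iff.1 h
    obtain ⟨b, hy, h⟩ := Option.bind_eq_some_iff.1 h
    exact ⟨a, b, hx, hy, h⟩
  · rintro ⟨a, b, rfl, rfl, h⟩
    exact h

theorem PartialValue.add_comm_aux (x y : PartialValue E) :
    PartialValue.add x y = PartialValue.add y x := by
  refine Option.ext fun c => ?_
  have key : ∀ x y : PartialValue E,
      PartialValue.add x y = some c → PartialValue.add y x = some c := by
    intro x y h
    obtain ⟨a, b, hx, hy, h⟩ := PartialValue.add_eq_some.1 h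
    exact PartialValue.add_eq_some.2 ⟨b, a, hy, hx, oplus_comm _ _ _ h⟩
  exact ⟨key x y, key y x⟩

theorem PartialValue.add_assoc_aux (x y z : PartialValue E) :
    PartialValue.add (PartialValue.add x y) z = PartialValue.add x (PartialValue.add y z) := by
  refine Option.ext fun e => ?_
  have key : ∀ x y z : PartialValue E,
      PartialValue.add (PartialValue.add x y) z = some e →
        PartialValue.add x (PartialValue.add y z) = some e := by
    intro x y z h
    obtain ⟨d, c, hxy, hz, h⟩ := PartialValue.add_eq_some.1 h
    obtain ⟨a, b, hx, hy, hab⟩ := PartialValue.add_eq_some.1 hxy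
    obtain ⟨f, hf, hf'⟩ := oplus_assoc _ _ _ _ _ hab h
    exact PartialValue.add_eq_some.2
      ⟨a, f, hx, PartialValue.add_eq_some.2 ⟨b, c, hy, hz, hf⟩, hf'⟩
  refine ⟨key x y z, fun h => ?_⟩
  rw [PartialValue.add_comm_aux x, PartialValue.add_comm_aux y] at h
  have h' := key z y x h
  rwa [PartialValue.add_comm_aux z, PartialValue.add_comm_aux y] at h'

theorem PartialValue.add_zero_aux (x : PartialValue E) :
    PartialValue.add x (some 0) = x := by
  match x with
  | none => rfl
  | some a => exact oplus_zero a

/-- Possibly undefined sums form a commutative monoid (`none` is absorbing), so that iterated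
sums are independent of order and bracketing; the empty sum is `0`. -/
instance instAddCommMonoidPartialValue : AddCommMonoid (PartialValue E) where
  add := PartialValue.add
  zero := (some 0 : Option E)
  add_assoc := PartialValue.add_assoc_aux
  zero_add x := (PartialValue.add_comm_aux _ x).trans (PartialValue.add_zero_aux x)
  add_zero := PartialValue.add_zero_aux
  add_comm := PartialValue.add_comm_aux
  nsmul := @nsmulRec _ ⟨(some 0 : Option E)⟩ ⟨PartialValue.add⟩

/-- An element of `E`, as a sum that is defined. -/
def toPartial (a : E) : PartialValue E := some a

/-- `HasOSum s c a`: the sum `⨁_{i ∈ s} c_i` exists and is equal to `a`. -/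
def HasOSum {ι : Type*} (s : Finset ι) (c : ι → E) (a : E) : Prop :=
  ∑ i ∈ s, toPartial (c i) = toPartial a

/-- A finite family `(c_1, …, c_n)` is orthogonal iff `c_1 ⊕ ⋯ ⊕ c_n` exists. -/
def IsOrthogonal {n : ℕ} (c : Fin n → E) : Prop :=
  ∃ a : E, HasOSum Finset.univ c a

/-- The finite set `F` is compatible with cover in `X`: some finite orthogonal family with
range in `X` has every element of `F` as the sum of a subfamily. -/
def FinsetCompatibleWithCoverIn (F : Finset E) (X : Set E) : Prop :=
  ∃ (n : ℕ) (c : Fin n → E), IsOrthogonal c ∧ Set.range c ⊆ X ∧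
    ∀ a ∈ F, ∃ A : Finset (Fin n), HasOSum A c a

/-- `M` is compatible with covers in `X`. -/
def CompatibleWithCoversIn (M X : Set E) : Prop :=
  ∀ F : Finset E, (F : Set E) ⊆ M → FinsetCompatibleWithCoverIn F X

/-- `M` is a compatible subset of `E`. -/
def IsCompatible (M : Set E) : Prop := CompatibleWithCoversIn M Set.univ

end Sums

/-- `E` is homogeneous. -/
def IsHomogeneous (E : Type u) [EffectAlgebra E] : Prop :=
  ∀ u v₁ v₂ w : E, oplus v₁ v₂ = some w → Le u w → Le u (compl w) →
    ∃ u₁ u₂ : E, Le u₁ v₁ ∧ Le u₂ v₂ ∧ oplus u₁ u₂ = some u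

/-- `E` satisfies the Riesz decomposition property. -/
def RieszDecomposition (E : Type u) [EffectAlgebra E] : Prop :=
  ∀ (n : ℕ) (v : Fin n → E) (w u : E), HasOSum Finset.univ v w → Le u w →
    ∃ t : Fin n → E, (∀ i, Le (t i) (v i)) ∧ HasOSum Finset.univ t u

end EffectAlgebra

open EffectAlgebra in
/-- A sub-effect algebra of `E`: a subset that contains `1` and is closed under
`a ⊖ b` for `b ≤ a`, where `a ⊖ b = c` means `b ⊕ c = a`. -/
structure SubEffectAlgebra (E : Type u) [EffectAlgebra E] where
  carrier : Set E
  one_mem : (1 : E) ∈ carrier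
  ominus_mem : ∀ a b c : E, a ∈ carrier → b ∈ carrier → oplus b c = some a → c ∈ carrier

namespace SubEffectAlgebra

open EffectAlgebra

variable {E : Type u} [EffectAlgebra E]

instance instSetLike : SetLike (SubEffectAlgebra E) E where
  coe := carrier
  coe_injective := by
    rintro ⟨S, _, _⟩ ⟨T, _, _⟩ h
    congr

/-- Sub-effect algebras are ordered by inclusion. -/
instance instPartialOrder : PartialOrder (SubEffectAlgebra E) := PartialOrder.ofSetLike _ _

theorem zero_mem (S : SubEffectAlgebra E) : (0 : E) ∈ S :=
  S.ominus_mem 1 1 0 S.one_mem S.one_mem (oplus_zero 1)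

theorem oplus_mem (S : SubEffectAlgebra E) {a b c : E} (ha : a ∈ S) (hb : b ∈ S)
    (h : oplus a b = some c) : c ∈ S := by
  obtain ⟨f, hf, hf'⟩ := oplus_assoc _ _ _ _ _ h (oplus_compl c)
  have h1 : f ∈ S := S.ominus_mem 1 a f S.one_mem ha hf'
  have h2 : compl c ∈ S := S.ominus_mem f b _ h1 hb hf
  exact S.ominus_mem 1 (compl c) c S.one_mem h2 (oplus_comm _ _ _ (oplus_compl c))

/-- The restriction of `⊕` to a sub-effect algebra. -/
def restrict (S : SubEffectAlgebra E) (a b : S) : Option S :=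
  match h : oplus (a : E) (b : E) with
  | none => none
  | some c => some ⟨c, S.oplus_mem a.2 b.2 h⟩

theorem restrict_eq_some (S : SubEffectAlgebra E) {a b c : S} :
    S.restrict a b = some c ↔ oplus (a : E) (b : E) = some (c : E) := by
  unfold restrict
  split
  · rename_i h
    simp [h]
  · rename_i d h
    simp [h, Subtype.ext_iff]

/-- A sub-effect algebra is an effect algebra with the restricted operation and the same
`0` and `1`. -/
instance instEffectAlgebra (S : SubEffectAlgebra E) : EffectAlgebra S where
  zero := ⟨0, S.zero_mem⟩
  one := ⟨1, S.one_mem⟩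
  oplus := S.restrict
  oplus_comm a b c h := S.restrict_eq_some.2 (oplus_comm _ _ _ (S.restrict_eq_some.1 h))
  oplus_assoc a b c d e h1 h2 := by
    obtain ⟨f, hf, hf'⟩ :=
      oplus_assoc _ _ _ _ _ (S.restrict_eq_some.1 h1) (S.restrict_eq_some.1 h2)
    exact ⟨⟨f, S.oplus_mem b.2 c.2 hf⟩, S.restrict_eq_some.2 hf, S.restrict_eq_some.2 hf'⟩
  exists_unique_compl a :=
    ⟨⟨compl (a : E), S.ominus_mem 1 a _ S.one_mem a.2 (oplus_compl _)⟩,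
      S.restrict_eq_some.2 (oplus_compl _),
      fun _ hb => Subtype.ext (compl_unique (S.restrict_eq_some.1 hb) (oplus_compl _))⟩
  eq_zero_of_oplus_one a b h :=
    Subtype.ext (eq_zero_of_oplus_one _ _ (S.restrict_eq_some.1 h))

/-- A block of `E` is a maximal sub-effect algebra satisfying the Riesz decomposition
property. -/
def IsBlock (B : SubEffectAlgebra E) : Prop :=
  Maximal (fun S : SubEffectAlgebra E => RieszDecomposition S) B

end SubEffectAlgebra

/-!
Split a member `x` of an orthogonal multiset into `{a, b}` when `a ⊕ b = x` and `a` is orthogonal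
to `x`. Homogeneity says exactly that two such splittings `{a, b}` and `{c, d}` of `x` can be
split further to a common `{c₁, a₁, c₂, b₁}`, because `c ≤ a ⊕ b` is orthogonal to `a ⊕ b`. Hence
repeated splitting is confluent, so the sums of parts of the refinements of a fixed multiset with
sum `1` behave like the sums of parts of a single multiset: any finitely many of them can be
compared inside one refinement. They form a sub-effect algebra, which inherits Riesz decomposition
from multisets. Zorn's lemma turns Riesz sub-effect algebras into blocks, and conversely the
decompositions demanded by homogeneity only involve the three terms of an orthogonal triple.
-/

section MultisetRefinement

variable {α : Type*} {r : α → Multiset α → Prop}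

theorem exists_parts_of_add_eq_add {s t u v : Multiset α} (h : s + t = u + v) :
    ∃ su sv tu tv, s = su + sv ∧ t = tu + tv ∧ u = su + tu ∧ v = sv + tv := by
  classical
  refine ⟨s ∩ u, s - u, u - s, t ∩ v, ?_, ?_, ?_, ?_⟩
  · rw [add_comm, Multiset.sub_add_inter]
  · rw [add_comm, Multiset.inter_add_sub_of_add_eq_add h]
  · rw [add_comm, Multiset.inter_comm, Multiset.sub_add_inter]
  · rw [add_comm, Multiset.inter_comm, Multiset.inter_add_sub_of_add_eq_add h.symm]

/-- `d'` arises from `d` by simultaneously replacing some of the members `x` by multisets `e` with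
`r x e`. -/
def ParallelStep (r : α → Multiset α → Prop) (d d' : Multiset α) : Prop :=
  ∃ D : Multiset (Multiset α), Multiset.Rel (fun x e => e = {x} ∨ r x e) d D ∧ D.join = d'

theorem parallelStep_zero_iff {d : Multiset α} : ParallelStep r 0 d ↔ d = 0 := by
  simp [ParallelStep, Multiset.rel_zero_left, eq_comm]

theorem parallelStep_add_iff {a b d : Multiset α} :
    ParallelStep r (a + b) d ↔
      ∃ a' b', ParallelStep r a a' ∧ ParallelStep r b b' ∧ d = a' + b' := by
  constructor
  · rintro ⟨D, hD, rfl⟩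
    obtain ⟨A, B, hA, hB, rfl⟩ := Multiset.rel_add_left.1 hD
    exact ⟨_, _, ⟨A, hA, rfl⟩, ⟨B, hB, rfl⟩, Multiset.join_add A B⟩
  · rintro ⟨_, _, ⟨A, hA, rfl⟩, ⟨B, hB, rfl⟩, rfl⟩
    exact ⟨A + B, hA.add hB, Multiset.join_add A B⟩

theorem ParallelStep.add {a a' b b' : Multiset α} (ha : ParallelStep r a a')
    (hb : ParallelStep r b b') : ParallelStep r (a + b) (a' + b') :=
  parallelStep_add_iff.2 ⟨a', b', ha, hb, rfl⟩

theorem parallelStep_singleton_iff {x : α} {e : Multiset α} :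
    ParallelStep r {x} e ↔ e = {x} ∨ r x e := by
  constructor
  · rintro ⟨D, hD, rfl⟩
    obtain ⟨e, D', he, hD', rfl⟩ := Multiset.rel_cons_left.1 hD
    obtain rfl := Multiset.rel_zero_left.1 hD'
    simpa using he
  · intro h
    exact ⟨{e}, Multiset.Rel.cons h Multiset.Rel.zero, Multiset.sum_singleton e⟩

theorem ParallelStep.refl (d : Multiset α) : ParallelStep r d d :=
  ⟨d.map ({·}), Multiset.rel_map_right.2 (Multiset.rel_refl_of_refl_on fun _ _ => .inl rfl),
    Multiset.bind_singleton d id |>.trans (Multiset.map_id d)⟩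

theorem ParallelStep.map_eq {M : Type*} [AddCommMonoid M] {φ : Multiset α →+ M}
    (hφ : ∀ x e, r x e → φ e = φ {x}) {d d' : Multiset α} (h : ParallelStep r d d') :
    φ d' = φ d := by
  induction d using Multiset.induction_on generalizing d' with
  | empty => rw [parallelStep_zero_iff.1 h]
  | cons x d ih =>
    rw [← Multiset.singleton_add, parallelStep_add_iff] at h
    obtain ⟨e, f, he, hf, rfl⟩ := h
    have hex : φ e = φ {x} := by
      obtain rfl | he := parallelStep_singleton_iff.1 he
      exacts [rfl, hφ x e he]
    rw [← Multiset.singleton_add, map_add, map_add, hex, ih hf]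

theorem ParallelStep.diamond
    (h : ∀ x e f, r x e → r x f → ∃ g, ParallelStep r e g ∧ ParallelStep r f g)
    {d e f : Multiset α} (he : ParallelStep r d e) (hf : ParallelStep r d f) :
    ∃ g, ParallelStep r e g ∧ ParallelStep r f g := by
  induction d using Multiset.induction_on generalizing e f with
  | empty =>
    obtain rfl := parallelStep_zero_iff.1 he
    obtain rfl := parallelStep_zero_iff.1 hf
    exact ⟨0, .refl 0, .refl 0⟩
  | cons x d ih =>
    rw [← Multiset.singleton_add, parallelStep_add_iff] at he hf
    obtain ⟨e₁, e₂, he₁, he₂, rfl⟩ := he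
    obtain ⟨f₁, f₂, hf₁, hf₂, rfl⟩ := hf
    obtain ⟨g₂, heg₂, hfg₂⟩ := ih he₂ hf₂
    have hx : ∃ g₁, ParallelStep r e₁ g₁ ∧ ParallelStep r f₁ g₁ := by
      obtain rfl | hre := parallelStep_singleton_iff.1 he₁
      · exact ⟨f₁, hf₁, .refl f₁⟩
      obtain rfl | hrf := parallelStep_singleton_iff.1 hf₁
      · exact ⟨e₁, .refl e₁, he₁⟩
      exact h x e₁ f₁ hre hrf
    obtain ⟨g₁, heg₁, hfg₁⟩ := hx
    exact ⟨g₁ + g₂, heg₁.add heg₂, hfg₁.add hfg₂⟩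

/-- `d'` arises from `d` by repeatedly replacing members `x` by multisets `e` with `r x e`. -/
def Refines (r : α → Multiset α → Prop) : Multiset α → Multiset α → Prop :=
  Relation.ReflTransGen (ParallelStep r)

theorem ParallelStep.refines {d d' : Multiset α} (h : ParallelStep r d d') : Refines r d d' :=
  .single h

theorem Refines.refl (d : Multiset α) : Refines r d d :=
  Relation.ReflTransGen.refl

theorem Refines.trans {d e f : Multiset α} (hde : Refines r d e) (hef : Refines r e f) :
    Refines r d f :=
  Relation.ReflTransGen.trans hde hef

theorem Refines.add_right {a a' : Multiset α} (h : Refines r a a') (b : Multiset α) :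
    Refines r (a + b) (a' + b) :=
  Relation.ReflTransGen.lift (· + b) (fun _ _ hstep => hstep.add (.refl b)) _ _ h

theorem Refines.exists_of_add_left {a b d : Multiset α} (h : Refines r (a + b) d) :
    ∃ a' b', Refines r a a' ∧ Refines r b b' ∧ d = a' + b' := by
  induction h with
  | refl => exact ⟨a, b, .refl a, .refl b, rfl⟩
  | tail _ hstep ih =>
    obtain ⟨a', b', ha, hb, rfl⟩ := ih
    obtain ⟨a'', b'', ha', hb', rfl⟩ := parallelStep_add_iff.1 hstep
    exact ⟨a'', b'', ha.trans ha'.refines, hb.trans hb'.refines, rfl⟩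

theorem Refines.map_eq {M : Type*} [AddCommMonoid M] {φ : Multiset α →+ M}
    (hφ : ∀ x e, r x e → φ e = φ {x}) {d d' : Multiset α} (h : Refines r d d') :
    φ d' = φ d := by
  induction h with
  | refl => rfl
  | tail _ hstep ih => exact (hstep.map_eq hφ).trans ih

theorem Refines.confluent
    (h : ∀ x e f, r x e → r x f → ∃ g, ParallelStep r e g ∧ ParallelStep r f g)
    {d e f : Multiset α} (he : Refines r d e) (hf : Refines r d f) :
    ∃ g, Refines r e g ∧ Refines r f g :=
  Relation.church_rosser (fun _ _ _ he hf =>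
    let ⟨g, heg, hfg⟩ := ParallelStep.diamond h he hf
    ⟨g, .single heg, .single hfg⟩) he hf

end MultisetRefinement

namespace EffectAlgebra

theorem toPartial_injective {E : Type u} : Function.Injective (toPartial : E → PartialValue E) :=
  Option.some_injective E

section PartialSums

variable {E : Type u} [EffectAlgebra E] {a b c d w : E} {s t : Multiset E}

theorem oplus_left_cancel (hb : oplus a b = some d) (hc : oplus a c = some d) : b = c := by
  have oplus_eq_one {x f : E} (hx : oplus a x = some d) (hf : oplus a (compl d) = some f) :
      oplus f x = some 1 := by
    obtain ⟨g, hg, hxg⟩ := oplus_assoc _ _ _ _ _ (oplus_comm _ _ _ hx) (oplus_compl d)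
    obtain rfl : f = g := Option.some.inj (hf.symm.trans hg)
    exact oplus_comm _ _ _ hxg
  obtain ⟨f, hf, -⟩ := oplus_assoc _ _ _ _ _ (oplus_comm _ _ _ hb) (oplus_compl d)
  exact compl_unique (oplus_eq_one hb hf) (oplus_eq_one hc hf)

theorem le_left (h : oplus a b = some c) : Le a c := ⟨b, h⟩

theorem le_right (h : oplus a b = some c) : Le b c := ⟨a, oplus_comm _ _ _ h⟩

theorem eq_zero_of_le_zero (h : Le a 0) : a = 0 := by
  obtain ⟨c, hc⟩ := h
  obtain ⟨f, hf, -⟩ := oplus_assoc _ _ _ _ _ (oplus_comm _ _ _ hc)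
    (oplus_comm _ _ _ (oplus_zero (1 : E)))
  exact eq_zero_of_oplus_one a f hf

/-- `a` and `b` are orthogonal: `a ⊕ b` exists. -/
def Orth (a b : E) : Prop := ∃ c : E, oplus a b = some c

theorem Orth.symm (h : Orth a b) : Orth b a :=
  let ⟨c, hc⟩ := h
  ⟨c, oplus_comm _ _ _ hc⟩

theorem Orth.mono_left (h : Orth c b) (hac : Le a c) : Orth a b := by
  obtain ⟨x, hx⟩ := hac
  obtain ⟨s, hs⟩ := h
  obtain ⟨f, hf, -⟩ := oplus_assoc _ _ _ _ _ (oplus_comm _ _ _ hx) hs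
  exact ⟨f, hf⟩

theorem Orth.mono (h : Orth c d) (hac : Le a c) (hbd : Le b d) : Orth a b :=
  ((h.mono_left hac).symm.mono_left hbd).symm

theorem orth_iff_le_compl : Orth a b ↔ Le a (compl b) := by
  constructor
  · rintro ⟨s, hs⟩
    obtain ⟨f, hf, hbf⟩ := oplus_assoc _ _ _ _ _ (oplus_comm _ _ _ hs) (oplus_compl s)
    exact ⟨_, compl_unique hbf (oplus_compl b) ▸ hf⟩
  · exact Orth.mono_left ⟨1, oplus_comm _ _ _ (oplus_compl b)⟩

theorem toPartial_add_eq_iff : toPartial a + toPartial b = toPartial c ↔ oplus a b = some c :=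
  Iff.rfl

theorem exists_of_add_eq_toPartial {x y : PartialValue E} (h : x + y = toPartial c) :
    ∃ a b : E, x = toPartial a ∧ y = toPartial b ∧ oplus a b = some c :=
  PartialValue.add_eq_some.1 h

theorem add_left_cancel_of_eq_toPartial {x y z : PartialValue E}
    (hy : x + y = toPartial d) (hz : x + z = toPartial d) : y = z := by
  obtain ⟨a, b, rfl, rfl, hb⟩ := exists_of_add_eq_toPartial hy
  obtain ⟨a', c, ha, rfl, hc⟩ := exists_of_add_eq_toPartial hz
  obtain rfl := toPartial_injective ha
  rw [oplus_left_cancel hb hc]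

/-- The possibly undefined sum of a multiset of elements. Finite families are handled as multisets
because only their sums matter, and these do not depend on the order of the terms. -/
def osum : Multiset E →+ PartialValue E :=
  Multiset.sumAddMonoidHom.comp (Multiset.mapAddMonoidHom toPartial)

theorem osum_singleton (a : E) : osum {a} = toPartial a :=
  Multiset.sum_singleton (toPartial a)

theorem osum_cons (a : E) (s : Multiset E) : osum (a ::ₘ s) = toPartial a + osum s := by
  rw [← Multiset.singleton_add, map_add, osum_singleton]

theorem osum_cons_eq_iff :
    osum (a ::ₘ s) = toPartial w ↔ ∃ b, osum s = toPartial b ∧ oplus a b = some w := by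
  rw [osum_cons]
  constructor
  · intro h
    obtain ⟨a', b, ha, hb, hab⟩ := exists_of_add_eq_toPartial h
    obtain rfl := toPartial_injective ha
    exact ⟨b, hb, hab⟩
  · rintro ⟨b, hb, hab⟩
    rw [hb, toPartial_add_eq_iff, hab]

theorem exists_of_osum_add (h : osum (s + t) = toPartial w) :
    ∃ a b, osum s = toPartial a ∧ osum t = toPartial b ∧ oplus a b = some w :=
  exists_of_add_eq_toPartial (map_add osum s t ▸ h)

theorem hasOSum_iff_osum {ι : Type*} {A : Finset ι} {c : ι → E} :
    HasOSum A c a ↔ osum (A.val.map c) = toPartial a := by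
  have hosum : osum (A.val.map c) = ∑ i ∈ A, toPartial (c i) :=
    congrArg Multiset.sum (Multiset.map_map toPartial c A.val)
  rw [HasOSum, hosum]

end PartialSums

section Splitting

variable {E : Type u} [EffectAlgebra E] {a b c d s u w x : E} {A B C U V W X e f : Multiset E}

/-- `e` consists of two elements with sum `x`, one of which is orthogonal to `x`. Splittings of
this kind are the ones that homogeneity can refine. -/
def IsSplitting (x : E) (e : Multiset E) : Prop :=
  ∃ a b : E, e = {a} + {b} ∧ oplus a b = some x ∧ Orth a x

theorem parallelStep_of_oplus_eq (hab : oplus a b = some x) (ha : Orth a x) :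
    ParallelStep IsSplitting {x} ({a} + {b}) :=
  parallelStep_singleton_iff.2 (.inr ⟨a, b, rfl, hab, ha⟩)

theorem osum_eq_of_refines (h : Refines IsSplitting A B) : osum B = osum A := by
  refine Refines.map_eq ?_ h
  rintro x _ ⟨a, b, rfl, hab, -⟩
  rw [map_add, osum_singleton, osum_singleton, osum_singleton, toPartial_add_eq_iff, hab]

theorem isHomogeneous_iff : IsHomogeneous E ↔
    ∀ u v₁ v₂ w : E, oplus v₁ v₂ = some w → Le u w → Orth u w →
      ∃ u₁ u₂ : E, Le u₁ v₁ ∧ Le u₂ v₂ ∧ oplus u₁ u₂ = some u := by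
  simp only [IsHomogeneous, orth_iff_le_compl]

theorem IsHomogeneous.isSplitting_diamond (hE : IsHomogeneous E) (he : IsSplitting x e)
    (hf : IsSplitting x f) :
    ∃ g, ParallelStep IsSplitting e g ∧ ParallelStep IsSplitting f g := by
  obtain ⟨a, b, rfl, hab, hax⟩ := he
  obtain ⟨c, d, rfl, hcd, hcx⟩ := hf
  obtain ⟨c₁, c₂, ⟨a₁, ha⟩, ⟨b₁, hb⟩, hc⟩ :=
    isHomogeneous_iff.1 hE c a b x hab (le_left hcd) hcx
  have hd : toPartial a₁ + toPartial b₁ = toPartial d := by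
    refine add_left_cancel_of_eq_toPartial (x := toPartial c) (d := x) ?_ hcd
    rw [← toPartial_add_eq_iff.2 hc, add_add_add_comm, toPartial_add_eq_iff.2 ha,
      toPartial_add_eq_iff.2 hb, toPartial_add_eq_iff.2 hab]
  refine ⟨({c₁} + {a₁}) + ({c₂} + {b₁}), ?_, ?_⟩
  · exact (parallelStep_of_oplus_eq ha (hcx.mono (le_left hc) (le_left hab))).add
      (parallelStep_of_oplus_eq hb (hcx.mono (le_right hc) (le_right hab)))
  · rw [add_add_add_comm]
    exact (parallelStep_of_oplus_eq hc (hax.mono (le_left ha) (le_left hcd))).add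
      (parallelStep_of_oplus_eq hd (hax.mono (le_right ha) (le_right hcd)))

theorem IsHomogeneous.exists_parallelStep_of_orth (hE : IsHomogeneous E)
    (hX : osum X = toPartial w) (huw : Le u w) (horth : Orth u w) :
    ∃ U V, ParallelStep IsSplitting X (U + V) ∧ osum U = toPartial u := by
  induction X using Multiset.induction_on generalizing u w with
  | empty =>
    obtain rfl : (0 : E) = w := toPartial_injective hX
    obtain rfl := eq_zero_of_le_zero huw
    exact ⟨0, 0, .refl 0, rfl⟩
  | cons x X ih =>
    obtain ⟨w₁, hw₁, hxw⟩ := osum_cons_eq_iff.1 hX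
    obtain ⟨u₀, u₁, ⟨v₀, hx⟩, hu₁, hu⟩ := isHomogeneous_iff.1 hE u x w₁ w hxw huw horth
    obtain ⟨U, V, hUV, hU⟩ := ih hw₁ hu₁ (horth.mono (le_right hu) (le_right hxw))
    refine ⟨{u₀} + U, {v₀} + V, ?_, osum_cons_eq_iff.2 ⟨u₁, hU, hu⟩⟩
    rw [← Multiset.singleton_add, add_add_add_comm]
    exact (parallelStep_of_oplus_eq hx (horth.mono (le_left hu) (le_left hxw))).add hUV

/-- The part that `W` and `U` share need not be split, and the rest of `U` is orthogonal to the
rest of `W`, so that homogeneity applies to these two. -/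
theorem IsHomogeneous.exists_parallelStep_of_le (hE : IsHomogeneous E)
    (hs : osum (W + C) = toPartial s) (hWC : W + C = U + V) (hW : osum W = toPartial w)
    (hU : osum U = toPartial u) (huw : Le u w) :
    ∃ U' V', ParallelStep IsSplitting W (U' + V') ∧ osum U' = toPartial u := by
  obtain ⟨I, W₁, U₁, D, rfl, rfl, rfl, rfl⟩ := exists_parts_of_add_eq_add hWC
  obtain ⟨i, w₁, hI, hW₁, hw⟩ := exists_of_osum_add hW
  obtain ⟨i', u₁, hI', hU₁, hu⟩ := exists_of_osum_add hU
  obtain rfl : i = i' := toPartial_injective (hI.symm.trans hI')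
  have hle : Le u₁ w₁ := by
    obtain ⟨z, hz⟩ := huw
    obtain ⟨f, hf, hif⟩ := oplus_assoc _ _ _ _ _ hu hz
    exact ⟨z, oplus_left_cancel hif hw ▸ hf⟩
  have horth : Orth u₁ w₁ := by
    have hparts : I + W₁ + (U₁ + D) = U₁ + W₁ + (I + D) := by abel
    obtain ⟨y, -, hy, -⟩ := exists_of_osum_add (hparts ▸ hs)
    obtain ⟨u', w', hu', hw', huw'⟩ := exists_of_osum_add hy
    obtain rfl := toPartial_injective (hU₁.symm.trans hu')
    obtain rfl := toPartial_injective (hW₁.symm.trans hw')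
    exact ⟨y, huw'⟩
  obtain ⟨P, Q, hPQ, hP⟩ := hE.exists_parallelStep_of_orth hW₁ hle horth
  refine ⟨I + P, Q, add_assoc I P Q ▸ (ParallelStep.refl I).add hPQ, ?_⟩
  rw [map_add, hI, hP, toPartial_add_eq_iff, hu]

end Splitting

section RefinementSums

variable {E : Type u} [EffectAlgebra E] {a b s u v₁ v₂ w : E} {A C W c : Multiset E}

/-- The sums of the parts of all multisets obtained from `c` by repeated splitting. For `c` with
sum `1` in a homogeneous effect algebra they form a Riesz sub-effect algebra containing `c`. -/
def refinementSums (c : Multiset E) : Set E :=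
  {a | ∃ A C, Refines IsSplitting c (A + C) ∧ osum A = toPartial a}

theorem mem_refinementSums (h : Refines IsSplitting c (A + C)) (ha : osum A = toPartial a) :
    a ∈ refinementSums c :=
  ⟨A, C, h, ha⟩

theorem IsHomogeneous.exists_refines_of_le (hE : IsHomogeneous E) (hc : osum c = toPartial s)
    (hWC : Refines IsSplitting c (W + C)) (hW : osum W = toPartial w)
    (hu : u ∈ refinementSums c) (huw : Le u w) :
    ∃ U V, Refines IsSplitting W (U + V) ∧ osum U = toPartial u := by
  obtain ⟨U, V, hUV, hU⟩ := hu
  obtain ⟨d, hWCd, hUVd⟩ := Refines.confluent (fun _ _ _ => hE.isSplitting_diamond) hWC hUV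
  obtain ⟨W', C', hW', -, rfl⟩ := hWCd.exists_of_add_left
  obtain ⟨U', V', hU', -, hparts⟩ := hUVd.exists_of_add_left
  obtain ⟨U'', V'', hstep, hU''⟩ := hE.exists_parallelStep_of_le
    ((osum_eq_of_refines (hWC.trans hWCd)).trans hc) hparts
    ((osum_eq_of_refines hW').trans hW) ((osum_eq_of_refines hU').trans hU) huw
  exact ⟨U'', V'', hW'.trans hstep.refines, hU''⟩

theorem IsHomogeneous.exists_refines_of_oplus_eq (hE : IsHomogeneous E)
    (hc : osum c = toPartial s) (ha : a ∈ refinementSums c) (hw : w ∈ refinementSums c)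
    (hab : oplus a b = some w) :
    ∃ A B C, Refines IsSplitting c (A + B + C) ∧ osum A = toPartial a ∧ osum B = toPartial b := by
  obtain ⟨W, C, hWC, hW⟩ := hw
  obtain ⟨A, B, hAB, hA⟩ := hE.exists_refines_of_le hc hWC hW ha (le_left hab)
  refine ⟨A, B, C, hWC.trans (hAB.add_right C), hA, ?_⟩
  refine add_left_cancel_of_eq_toPartial (x := toPartial a) (d := w) ?_ hab
  rw [← hA, ← map_add, osum_eq_of_refines hAB, hW]

theorem IsHomogeneous.mem_refinementSums_of_oplus_eq (hE : IsHomogeneous E)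
    (hc : osum c = toPartial s) (ha : a ∈ refinementSums c) (hw : w ∈ refinementSums c)
    (hab : oplus a b = some w) : b ∈ refinementSums c := by
  obtain ⟨A, B, C, hABC, -, hB⟩ := hE.exists_refines_of_oplus_eq hc ha hw hab
  rw [add_comm A, add_assoc] at hABC
  exact mem_refinementSums hABC hB

theorem IsHomogeneous.exists_decomposition_mem_refinementSums (hE : IsHomogeneous E)
    (hc : osum c = toPartial s) (hu : u ∈ refinementSums c) (hv₁ : v₁ ∈ refinementSums c)
    (hw : w ∈ refinementSums c) (hv : oplus v₁ v₂ = some w) (huw : Le u w) :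
    ∃ u₁ ∈ refinementSums c, ∃ u₂ ∈ refinementSums c,
      Le u₁ v₁ ∧ Le u₂ v₂ ∧ oplus u₁ u₂ = some u := by
  obtain ⟨A, B, C, hABC, hA, hB⟩ := hE.exists_refines_of_oplus_eq hc hv₁ hw hv
  have hAB : osum (A + B) = toPartial w := by rw [map_add, hA, hB, toPartial_add_eq_iff, hv]
  obtain ⟨U, V, hUV, hU⟩ := hE.exists_refines_of_le hc hABC hAB hu huw
  obtain ⟨A', B', hA', hB', hparts⟩ := hUV.exists_of_add_left
  obtain ⟨U₁, U₂, V₁, V₂, rfl, rfl, rfl, rfl⟩ := exists_parts_of_add_eq_add hparts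
  obtain ⟨u₁, u₂, hU₁, hU₂, hu₁₂⟩ := exists_of_osum_add hU
  have hc' : Refines IsSplitting c (U₁ + U₂ + (V₁ + V₂) + C) := hABC.trans (hUV.add_right C)
  refine ⟨u₁, mem_refinementSums (C := U₂ + (V₁ + V₂) + C) ?_ hU₁,
    u₂, mem_refinementSums (C := U₁ + (V₁ + V₂) + C) ?_ hU₂, ?_, ?_, hu₁₂⟩
  · convert hc' using 1; abel
  · convert hc' using 1; abel
  · obtain ⟨u₁', y, hU₁', -, hy⟩ := exists_of_osum_add ((osum_eq_of_refines hA').trans hA)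
    exact toPartial_injective (hU₁.symm.trans hU₁') ▸ le_left hy
  · obtain ⟨u₂', y, hU₂', -, hy⟩ := exists_of_osum_add ((osum_eq_of_refines hB').trans hB)
    exact toPartial_injective (hU₂.symm.trans hU₂') ▸ le_left hy

end RefinementSums

theorem rieszDecomposition_iff_two {E : Type u} [EffectAlgebra E] : RieszDecomposition E ↔
    ∀ u v₁ v₂ w : E, oplus v₁ v₂ = some w → Le u w →
      ∃ u₁ u₂ : E, Le u₁ v₁ ∧ Le u₂ v₂ ∧ oplus u₁ u₂ = some u := by
  constructor
  · intro h u v₁ v₂ w hw hu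
    obtain ⟨t, ht, hs⟩ := h 2 ![v₁, v₂] w u (by rw [HasOSum, Fin.sum_univ_two]; exact hw) hu
    rw [HasOSum, Fin.sum_univ_two] at hs
    exact ⟨t 0, t 1, ht 0, ht 1, hs⟩
  · intro h n
    induction n with
    | zero =>
      intro v w u hw hu
      obtain rfl : (0 : E) = w := toPartial_injective hw
      obtain rfl := eq_zero_of_le_zero hu
      exact ⟨v, fun i => i.elim0, rfl⟩
    | succ n ih =>
      intro v w u hw hu
      rw [HasOSum, Fin.sum_univ_succ] at hw
      obtain ⟨v₀, w₁, hv₀, hw₁, hw⟩ := exists_of_add_eq_toPartial hw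
      obtain rfl := toPartial_injective hv₀
      obtain ⟨u₀, u₁, hu₀, hu₁, hu⟩ := h u _ _ w hw hu
      obtain ⟨t, ht, hs⟩ := ih _ w₁ u₁ hw₁ hu₁
      refine ⟨Fin.cons u₀ t, Fin.cases hu₀ ht, ?_⟩
      rw [HasOSum] at hs
      simp only [HasOSum, Fin.sum_univ_succ, Fin.cons_zero, Fin.cons_succ, hs]
      exact hu

end EffectAlgebra

namespace SubEffectAlgebra

open EffectAlgebra

variable {E : Type u} [EffectAlgebra E]

theorem le_coe_iff (S : SubEffectAlgebra E) {a b : S} : Le (a : E) (b : E) ↔ Le a b := by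
  constructor
  · rintro ⟨c, hc⟩
    exact ⟨⟨c, S.ominus_mem b a c b.2 a.2 hc⟩, S.restrict_eq_some.2 hc⟩
  · rintro ⟨c, hc⟩
    exact ⟨c, S.restrict_eq_some.1 hc⟩

theorem rieszDecomposition_iff (S : SubEffectAlgebra E) :
    RieszDecomposition S ↔ ∀ u ∈ S, ∀ v₁ ∈ S, ∀ v₂ ∈ S, ∀ w, oplus v₁ v₂ = some w → Le u w →
      ∃ u₁ ∈ S, ∃ u₂ ∈ S, Le u₁ v₁ ∧ Le u₂ v₂ ∧ oplus u₁ u₂ = some u := by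
  rw [rieszDecomposition_iff_two]
  constructor
  · intro h u hu v₁ hv₁ v₂ hv₂ w hw huw
    obtain ⟨u₁, u₂, hu₁, hu₂, hu₁₂⟩ := h ⟨u, hu⟩ ⟨v₁, hv₁⟩ ⟨v₂, hv₂⟩
      ⟨w, S.oplus_mem hv₁ hv₂ hw⟩ (S.restrict_eq_some.2 hw) (S.le_coe_iff.1 huw)
    exact ⟨u₁, u₁.2, u₂, u₂.2, S.le_coe_iff.2 hu₁, S.le_coe_iff.2 hu₂,
      S.restrict_eq_some.1 hu₁₂⟩
  · intro h u v₁ v₂ w hw huw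
    obtain ⟨u₁, mem₁, u₂, mem₂, hu₁, hu₂, hu₁₂⟩ := h u u.2 v₁ v₁.2 v₂ v₂.2 w
      (S.restrict_eq_some.1 hw) (S.le_coe_iff.2 huw)
    exact ⟨⟨u₁, mem₁⟩, ⟨u₂, mem₂⟩, S.le_coe_iff.1 hu₁, S.le_coe_iff.1 hu₂,
      S.restrict_eq_some.2 hu₁₂⟩

/-- The union of a nonempty directed set of sub-effect algebras; it bounds chains from above in
Zorn's lemma. -/
def directedUnion (D : Set (SubEffectAlgebra E)) (hne : D.Nonempty) (hD : DirectedOn (· ≤ ·) D) :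
    SubEffectAlgebra E where
  carrier := {a | ∃ S ∈ D, a ∈ S}
  one_mem := let ⟨S, hS⟩ := hne; ⟨S, hS, S.one_mem⟩
  ominus_mem := by
    rintro a b c ⟨S, hS, ha⟩ ⟨T, hT, hb⟩ h
    obtain ⟨U, hU, hSU, hTU⟩ := hD S hS T hT
    exact ⟨U, hU, U.ominus_mem a b c (hSU ha) (hTU hb) h⟩

theorem rieszDecomposition_directedUnion {D : Set (SubEffectAlgebra E)} (hne : D.Nonempty)
    (hD : DirectedOn (· ≤ ·) D) (h : ∀ S ∈ D, RieszDecomposition S) :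
    RieszDecomposition (directedUnion D hne hD) := by
  rw [rieszDecomposition_iff]
  rintro u ⟨S, hS, hu⟩ v₁ ⟨S₁, hS₁, hv₁⟩ v₂ ⟨S₂, hS₂, hv₂⟩ w hw huw
  obtain ⟨T, hT, hS₁T, hS₂T⟩ := hD S₁ hS₁ S₂ hS₂
  obtain ⟨U, hU, hSU, hTU⟩ := hD S hS T hT
  obtain ⟨u₁, mem₁, u₂, mem₂, hu₁₂⟩ := U.rieszDecomposition_iff.1 (h U hU) u (hSU hu)
    v₁ (hTU (hS₁T hv₁)) v₂ (hTU (hS₂T hv₂)) w hw huw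
  exact ⟨u₁, ⟨U, hU, mem₁⟩, u₂, ⟨U, hU, mem₂⟩, hu₁₂⟩

theorem exists_isBlock_ge {S : SubEffectAlgebra E} (hS : RieszDecomposition S) :
    ∃ B : SubEffectAlgebra E, B.IsBlock ∧ S ≤ B := by
  obtain ⟨B, hSB, hB⟩ := zorn_le_nonempty₀ {S : SubEffectAlgebra E | RieszDecomposition S}
    (fun C hCR hC T hT => ⟨directedUnion C ⟨T, hT⟩ hC.directedOn,
      rieszDecomposition_directedUnion ⟨T, hT⟩ hC.directedOn hCR,
      fun U hU _ ha => ⟨U, hU, ha⟩⟩) S hS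
  exact ⟨B, hB, hSB⟩

theorem exists_isBlock_superset_iff (M : Set E) :
    (∃ B : SubEffectAlgebra E, B.IsBlock ∧ M ⊆ (B : Set E)) ↔
      ∃ R : SubEffectAlgebra E, RieszDecomposition R ∧ M ⊆ (R : Set E) := by
  constructor
  · rintro ⟨B, hB, hMB⟩
    exact ⟨B, hB.prop, hMB⟩
  · rintro ⟨R, hR, hMR⟩
    obtain ⟨B, hB, hRB⟩ := exists_isBlock_ge hR
    exact ⟨B, hB, hMR.trans hRB⟩

end SubEffectAlgebra

namespace EffectAlgebra

variable {E : Type u} [EffectAlgebra E]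

/-- The sub-effect algebra of the sums of parts of multisets obtained by repeatedly splitting a
multiset with sum `1`. -/
def IsHomogeneous.refinementSubalgebra (hE : IsHomogeneous E) (c : Multiset E)
    (hc : osum c = toPartial (1 : E)) : SubEffectAlgebra E where
  carrier := refinementSums c
  one_mem := mem_refinementSums (C := 0) (by rw [add_zero]; exact .refl c) hc
  ominus_mem _ _ _ ha hb h := hE.mem_refinementSums_of_oplus_eq hc hb ha h

theorem IsHomogeneous.rieszDecomposition_refinementSubalgebra (hE : IsHomogeneous E)
    (c : Multiset E) (hc : osum c = toPartial (1 : E)) :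
    RieszDecomposition (hE.refinementSubalgebra c hc) := by
  rw [SubEffectAlgebra.rieszDecomposition_iff]
  exact fun u hu v₁ hv₁ v₂ hv₂ w hw huw => hE.exists_decomposition_mem_refinementSums hc hu hv₁
    ((hE.refinementSubalgebra c hc).oplus_mem hv₁ hv₂ hw) hw huw

theorem IsHomogeneous.exists_rieszDecomposition_of_osum (hE : IsHomogeneous E) {c : Multiset E}
    {s : E} (hc : osum c = toPartial s) :
    ∃ R : SubEffectAlgebra E, RieszDecomposition R ∧
      ∀ A ≤ c, ∀ a, osum A = toPartial a → a ∈ R := by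
  have hone : osum (compl s ::ₘ c) = toPartial 1 :=
    osum_cons_eq_iff.2 ⟨s, hc, oplus_comm _ _ _ (oplus_compl s)⟩
  refine ⟨_, hE.rieszDecomposition_refinementSubalgebra _ hone, fun A hA a ha => ?_⟩
  obtain ⟨C, hC⟩ := Multiset.le_iff_exists_add.1 (hA.trans (Multiset.le_cons_self c (compl s)))
  refine mem_refinementSums (C := C) ?_ ha
  rw [← hC]
  exact .refl _

theorem IsHomogeneous.exists_rieszDecomposition_of_isCompatible (hE : IsHomogeneous E)
    {M : Set E} (hM : M.Finite) (hMc : IsCompatible M) :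
    ∃ R : SubEffectAlgebra E, RieszDecomposition R ∧ M ⊆ (R : Set E) := by
  obtain ⟨n, c, ⟨s, hs⟩, -, hcover⟩ := hMc hM.toFinset hM.coe_toFinset.subset
  obtain ⟨R, hR, hmem⟩ := hE.exists_rieszDecomposition_of_osum (hasOSum_iff_osum.1 hs)
  refine ⟨R, hR, fun a ha => ?_⟩
  obtain ⟨A, hA⟩ := hcover a (hM.mem_toFinset.2 ha)
  exact hmem _ (Multiset.map_le_map (Finset.val_le_iff.2 A.subset_univ)) a
    (hasOSum_iff_osum.1 hA)

theorem IsOrthogonal.isCompatible_range {n : ℕ} {c : Fin n → E} (hc : IsOrthogonal c) :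
    IsCompatible (Set.range c) := by
  refine fun F hF => ⟨n, c, hc, Set.subset_univ _, fun a ha => ?_⟩
  obtain ⟨i, rfl⟩ := hF ha
  exact ⟨{i}, Finset.sum_singleton _ _⟩

theorem isOrthogonal_triple {a b c d : E} (hab : oplus a b = some d) (hd : Orth d c) :
    IsOrthogonal ![a, b, c] := by
  obtain ⟨s, hs⟩ := hd
  refine ⟨s, ?_⟩
  rw [HasOSum, Fin.sum_univ_three]
  change toPartial a + toPartial b + toPartial c = toPartial s
  rw [toPartial_add_eq_iff.2 hab, toPartial_add_eq_iff, hs]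

theorem isHomogeneous_of_isOrthogonal_triple
    (h : ∀ c : Fin 3 → E, IsOrthogonal c →
      ∃ R : SubEffectAlgebra E, RieszDecomposition R ∧ Set.range c ⊆ (R : Set E)) :
    IsHomogeneous E := by
  rw [isHomogeneous_iff]
  intro u v₁ v₂ w hw huw horth
  obtain ⟨R, hR, hc⟩ := h ![v₁, v₂, u] (isOrthogonal_triple hw horth.symm)
  obtain ⟨u₁, -, u₂, -, hu⟩ := R.rieszDecomposition_iff.1 hR u (hc ⟨2, rfl⟩) v₁ (hc ⟨0, rfl⟩)
    v₂ (hc ⟨1, rfl⟩) w hw huw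
  exact ⟨u₁, u₂, hu⟩

end EffectAlgebra

theorem mainTheorem10 (E : Type u) [EffectAlgebra E] :
    List.TFAE [
      EffectAlgebra.IsHomogeneous E,
      ∀ M : Set E, M.Finite → EffectAlgebra.IsCompatible M →
        ∃ B : SubEffectAlgebra E, B.IsBlock ∧ M ⊆ (B : Set E),
      ∀ M : Set E, M.Finite → EffectAlgebra.IsCompatible M →
        ∃ R : SubEffectAlgebra E, EffectAlgebra.RieszDecomposition R ∧ M ⊆ (R : Set E),
      ∀ (n : ℕ) (c : Fin n → E), EffectAlgebra.IsOrthogonal c →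
        ∃ B : SubEffectAlgebra E, B.IsBlock ∧ Set.range c ⊆ (B : Set E),
      ∀ (n : ℕ) (c : Fin n → E), EffectAlgebra.IsOrthogonal c →
        ∃ R : SubEffectAlgebra E, EffectAlgebra.RieszDecomposition R ∧
          Set.range c ⊆ (R : Set E),
      ∀ c : Fin 3 → E, EffectAlgebra.IsOrthogonal c →
        ∃ B : SubEffectAlgebra E, B.IsBlock ∧ Set.range c ⊆ (B : Set E),
      ∀ c : Fin 3 → E, EffectAlgebra.IsOrthogonal c →
        ∃ R : SubEffectAlgebra E, EffectAlgebra.RieszDecomposition R ∧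
          Set.range c ⊆ (R : Set E)] := by
  simp only [SubEffectAlgebra.exists_isBlock_superset_iff]
  tfae_have 2 ↔ 3 := Iff.rfl
  tfae_have 4 ↔ 5 := Iff.rfl
  tfae_have 6 ↔ 7 := Iff.rfl
  tfae_have 1 → 3 := fun hE _ => hE.exists_rieszDecomposition_of_isCompatible
  tfae_have 3 → 5 := fun h _ c hc => h (Set.range c) (Set.finite_range c) hc.isCompatible_range
  tfae_have 5 → 7 := fun h => h 3
  tfae_have 7 → 1 := EffectAlgebra.isHomogeneous_of_isOrthogonal_triple
  tfae_finish
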